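/- Let $X$ and $Y$ be realcompact topological spaces and let $E$ and $F$ be nonzero Hausdorff topological vector spaces, each over $\mathbb{R}$ or $\mathbb{C}$. Let $C(X,E)$ denote the space of all continuous functions $X\to E$, and similarly $C(Y,F)$. If there is a biseparating map $T:C(X,E)\to C(Y,F)$ (not assumed to be linear or additive), then $X$ and $Y$ are homeomorphic. Here a Hausdorff completely regular space $X$ is called realcompact if for every $x_0\in\beta X\setminus X$ (where $\beta X$ is the Stone–Čech compactification of $X$) there is a continuous function $f:\beta X\to[0,1]$ with $f(x_0)=1$ and $f(x)<1$ for all $x\in X$. For $f,g,h\in C(X,E)$ write $f\perp_h g$ if there is no $x \in X$ with both $f(x)\neq h(x)$ and $g(x)\neq h(x)$; the same notation is used in $C(Y,F)$. A map $T:C(X,E)\to C(Y,F)$ is called biseparating if it is a bijection and, for all $f,g,h\in C(X,E)$, $$f\perp_h g \iff Tf\perp_{Th}Tg .$$ -/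

import Mathlib

/-- The carrier `C(f) = {x | f x ≠ 0}` of a vector-valued function. -/
def carrier {X E : Type*} [Zero E] (f : X → E) : Set X := {x | f x ≠ 0}

/-- `DisjointWrt h f g` is the relation `f ⊥_h g`: the carriers of `f - h` and `g - h`
do not meet. -/
def DisjointWrt {X E : Type*} [AddGroup E] (h f g : X → E) : Prop :=
  carrier (f - h) ∩ carrier (g - h) = ∅

/-- A (not necessarily linear or additive) map `T : C(X, E) → C(Y, F)` is biseparating if it is
a bijection and `f ⊥_h g ↔ T f ⊥_{T h} T g` for all `f g h`. -/
structure IsBiseparating {X Y E F : Type*} [TopologicalSpace X] [TopologicalSpace Y]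
    [TopologicalSpace E] [AddGroup E] [TopologicalSpace F] [AddGroup F]
    (T : C(X, E) → C(Y, F)) : Prop where
  bijective : Function.Bijective T
  disjointWrt_iff : ∀ f g h : C(X, E), DisjointWrt h f g ↔ DisjointWrt (T h) (T f) (T g)

/-- A Hausdorff completely regular space `X` is realcompact if for every `x₀ ∈ βX \ X` there is a
continuous `f : βX → [0, 1]` with `f x₀ = 1` and `f x < 1` for all `x ∈ X`. Here `X` is regarded as
a subspace of its Stone–Čech compactification through the embedding `stoneCechUnit`. -/
class RealcompactSpace (X : Type*) [TopologicalSpace X] : Prop extends T35Space X where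
  exists_eq_one_lt_one : ∀ x₀ : StoneCech X, x₀ ∉ Set.range (stoneCechUnit : X → StoneCech X) →
    ∃ f : C(StoneCech X, unitInterval), f x₀ = 1 ∧ ∀ x : X, f (stoneCechUnit x) < 1

/-! A biseparating map preserves pointwise betweenness: at each point `h` takes a value of `f` or of
`g`. `transportOpen` moves an open `U` to the open set of `Y` on which data on `U` determines
images. The crux, `PreservesBetween.eq_of_eq_on_transportOpen`, is that this set in turn determines
functions on `U`. So transporting there and back gives a set between `U` and its closure, and
`TransportRel` is symmetric, continuous and single-valued.

Compactness of `βY` gives each `x` a partner. Were it outside `Y`, realcompactness would give a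
function on `Y` unbounded near it. Gluing images of constants `m • a` along its level bands and
pulling back would give a continuous function taking arbitrarily large multiples of `a` near `x`,
which is impossible. -/

/-- For completely regular `X`, a point of an open set is separated from the complement by a
continuous real function. -/
lemma exists_continuous_real_eq_zero_eq_one {X : Type*} [TopologicalSpace X]
    [CompletelyRegularSpace X] {x : X} {U : Set X} (hU : IsOpen U) (hx : x ∈ U) :
    ∃ w : C(X, ℝ), w x = 0 ∧ ∀ z, z ∉ U → w z = 1 := by
  obtain ⟨f, hf, h0, h1⟩ := CompletelyRegularSpace.completely_regular_isOpen x U hU hx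
  refine ⟨⟨fun z => (f z : ℝ), by fun_prop⟩, by simp [h0], fun z hz => ?_⟩
  have := h1 hz
  simp [this]

/-- A bijection between function spaces that preserves the relation
"`h` takes at every point one of the values of `f` and `g`". -/
def PreservesBetween {X Y E F : Type*} [TopologicalSpace X] [TopologicalSpace Y]
    [TopologicalSpace E] [TopologicalSpace F] (e : C(X, E) ≃ C(Y, F)) : Prop :=
  ∀ f g h : C(X, E), (∀ x, h x = f x ∨ h x = g x) ↔ ∀ y, e h y = e f y ∨ e h y = e g y

/-- The interior of the set of points at which `e f` and `e g` agree whenever `f` and `g` agree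
on `U`. -/
def transportOpen {X Y E F : Type*} [TopologicalSpace X] [TopologicalSpace Y]
    [TopologicalSpace E] [TopologicalSpace F] (e : C(X, E) ≃ C(Y, F)) (U : Set X) : Set Y :=
  interior {y | ∀ f g : C(X, E), (∀ x ∈ U, f x = g x) → e f y = e g y}

/-- Any two functions can be glued along `U` and `V`. -/
def FunctionSeparated {X : Type*} (E : Type*) [TopologicalSpace X] [TopologicalSpace E]
    (U V : Set X) : Prop :=
  ∀ p q : C(X, E), ∃ f : C(X, E), (∀ x ∈ U, f x = p x) ∧ ∀ x ∈ V, f x = q x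

/-- The function that equals `f` where `φ = 0` and `g` where `φ = 1`. -/
def blend {X E : Type*} [TopologicalSpace X] [TopologicalSpace E] [AddCommGroup E] [Module ℝ E]
    [IsTopologicalAddGroup E] [ContinuousSMul ℝ E] (φ : C(X, ℝ)) (f g : C(X, E)) : C(X, E) :=
  ⟨fun x => f x + φ x • (g x - f x), by fun_prop⟩

/-! ### Gluing by cutoff functions -/

section Blend

variable {X E : Type*} [TopologicalSpace X] [TopologicalSpace E] [AddCommGroup E] [Module ℝ E]
    [IsTopologicalAddGroup E] [ContinuousSMul ℝ E]

lemma blend_of_eq_zero {φ : C(X, ℝ)} (f g : C(X, E)) {x : X} (h : φ x = 0) :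
    blend φ f g x = f x := by simp [blend, h]

lemma blend_of_eq_one {φ : C(X, ℝ)} (f g : C(X, E)) {x : X} (h : φ x = 1) :
    blend φ f g x = g x := by simp [blend, h]

lemma functionSeparated_lt_gt (w : C(X, ℝ)) :
    FunctionSeparated E {x | w x < 1 / 3} {x | 2 / 3 < w x} := by
  intro p q
  refine ⟨blend ⟨fun x => max 0 (min 1 (3 * w x - 1)), by fun_prop⟩ p q,
    fun x hx => blend_of_eq_zero _ _ ?_, fun x hx => blend_of_eq_one _ _ ?_⟩
  · simp only [Set.mem_ofPred_eq] at hx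
    simp only [ContinuousMap.coe_mk]
    exact max_eq_left (min_le_of_right_le (by linarith))
  · simp only [Set.mem_ofPred_eq] at hx
    simp only [ContinuousMap.coe_mk]
    rw [min_eq_left (by linarith)]
    norm_num

end Blend

/-- Gluing two distinct constants would give both values at a common closure point. -/
lemma FunctionSeparated.disjoint_closure {X E : Type*} [TopologicalSpace X] [TopologicalSpace E]
    [T2Space E] [Nontrivial E] {U V : Set X} (h : FunctionSeparated E U V) :
    Disjoint (closure U) (closure V) := by
  obtain ⟨a, b, hab⟩ := exists_pair_ne E
  obtain ⟨f, hU, hV⟩ := h (ContinuousMap.const X a) (ContinuousMap.const X b)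
  rw [Set.disjoint_left]
  intro x hx hx'
  have h1 : f x = a := closure_minimal (t := {x | f x = a}) (fun x hx => hU x hx)
    (isClosed_eq f.continuous continuous_const) hx
  have h2 : f x = b := closure_minimal (t := {x | f x = b}) (fun x hx => hV x hx)
    (isClosed_eq f.continuous continuous_const) hx'
  exact hab (h1.symm.trans h2)

/-! ### Transport of sets and betweenness squares -/

section Transport

variable {X Y E F : Type*} [TopologicalSpace X] [TopologicalSpace Y]
    [TopologicalSpace E] [TopologicalSpace F] {e : C(X, E) ≃ C(Y, F)}

lemma PreservesBetween.symm (he : PreservesBetween e) : PreservesBetween e.symm := by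
  intro f g h
  simpa using (he (e.symm f) (e.symm g) (e.symm h)).symm

lemma isOpen_transportOpen (e : C(X, E) ≃ C(Y, F)) (U : Set X) : IsOpen (transportOpen e U) :=
  isOpen_interior

lemma eq_of_mem_transportOpen {U : Set X} {f g : C(X, E)} (h : ∀ x ∈ U, f x = g x) {y : Y}
    (hy : y ∈ transportOpen e U) : e f y = e g y :=
  interior_subset hy f g h

lemma transportOpen_mono {U V : Set X} (h : U ⊆ V) : transportOpen e U ⊆ transportOpen e V :=
  interior_mono fun _ hy f g hfg => hy f g fun x hx => hfg x (h hx)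

lemma transportOpen_empty [Nontrivial F] : transportOpen e ∅ = ∅ := by
  obtain ⟨a, b, hab⟩ := exists_pair_ne F
  refine Set.eq_empty_of_forall_notMem fun y hy => hab ?_
  simpa using eq_of_mem_transportOpen (f := e.symm (ContinuousMap.const Y a))
    (g := e.symm (ContinuousMap.const Y b)) (by simp) hy

lemma FunctionSeparated.transportOpen {U V : Set X} (h : FunctionSeparated E U V) :
    FunctionSeparated F (transportOpen e U) (transportOpen e V) := by
  intro p q
  obtain ⟨f, hU, hV⟩ := h (e.symm p) (e.symm q)
  exact ⟨e f, fun y hy => by simpa using eq_of_mem_transportOpen hU hy,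
    fun y hy => by simpa using eq_of_mem_transportOpen hV hy⟩

/-- Four functions that form a square for betweenness are sent to functions whose parallel sides
differ at the same points, disjoint from those where the adjacent sides differ. -/
lemma PreservesBetween.square (he : PreservesBetween e) {a b c d : C(X, E)}
    (h : ∀ x, (b x = a x ∧ d x = c x) ∨ (a x = d x ∧ b x = c x)) (y : Y) :
    (e b y = e a y ∧ e d y = e c y) ∨ (e a y = e d y ∧ e b y = e c y) := by
  -- Each corner agrees at every point with one of its two neighbours.
  have hb := (he a c b).1 (fun x => by grind) y
  have hd := (he a c d).1 (fun x => by grind) y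
  have ha := (he b d a).1 (fun x => by grind) y
  have hc := (he b d c).1 (fun x => by grind) y
  grind

end Transport

section Real

variable {X Y E F : Type*} [TopologicalSpace X] [TopologicalSpace Y]
    [AddCommGroup E] [Module ℝ E] [TopologicalSpace E] [IsTopologicalAddGroup E]
    [ContinuousSMul ℝ E] [T2Space E] [Nontrivial E]
    [AddCommGroup F] [Module ℝ F] [TopologicalSpace F] [IsTopologicalAddGroup F]
    [ContinuousSMul ℝ F] [T2Space F] [Nontrivial F]
    {e : C(X, E) ≃ C(Y, F)}

omit [T2Space E] [Nontrivial E] [AddCommGroup F] [Module ℝ F] [IsTopologicalAddGroup F]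
  [ContinuousSMul ℝ F] [Nontrivial F] in
-- If `f` and `g` differ in `U`, a local change `f'` of `f` towards `g` gives a point where `e f`
-- differs from both `e f'` and `e g`; changes made inside `U` are visible only on the transport of
-- `U`.
lemma PreservesBetween.eq_of_eq_on_transportOpen [CompletelyRegularSpace X]
    (he : PreservesBetween e) {U : Set X} (hU : IsOpen U) {f g : C(X, E)}
    (h : ∀ y ∈ transportOpen e U, e f y = e g y) {x : X} (hx : x ∈ U) : f x = g x := by
  by_contra hfg
  obtain ⟨w, hw0, hw1⟩ := exists_continuous_real_eq_zero_eq_one hU hx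
  -- The cutoffs are nested: `ψ` is `1` wherever `φ` is nonzero, and `ψ` vanishes off `U`.
  let φ : C(X, ℝ) := ⟨fun z => max 0 (min 1 (1 - 2 * w z)), by fun_prop⟩
  let ψ : C(X, ℝ) := ⟨fun z => max 0 (min 1 (2 - 2 * w z)), by fun_prop⟩
  have hφx : φ x = 1 := by simp [φ, hw0]
  have hψU : ∀ z, z ∉ U → ψ z = 0 := fun z hz => by simp [ψ, hw1 z hz]
  have hφψ : ∀ z, φ z = 0 ∨ ψ z = 1 := by
    intro z
    rcases le_total (w z) (1 / 2) with hz | hz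
    · right
      simp only [ψ, ContinuousMap.coe_mk]
      rw [min_eq_left (by linarith)]
      norm_num
    · left
      exact max_eq_left (min_le_of_right_le (by linarith))
  set f' := blend φ f g with hf'
  have hne : ¬ ∀ z, f z = f' z ∨ f z = g z := fun H => by
    rcases H x with H | H
    · exact hfg (by rw [H, hf', blend_of_eq_one _ _ hφx])
    · exact hfg H
  rw [he f' g f] at hne
  push Not at hne
  obtain ⟨y, hy1, hy2⟩ := hne
  refine hy2 (h y (mem_interior.2 ⟨{y | e f y ≠ e f' y}, ?_,
    isOpen_ne_fun (e f).continuous (e f').continuous, hy1⟩))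
  intro z hz p q hpq
  by_contra hne
  set n := blend ψ p f with hn
  -- Here `n` and `k` are `p` and `q` with `f` spliced in where `ψ = 1`.
  set k := blend ψ q f with hk
  set n' := blend φ n g with hn'
  -- the sides `f f'` and `n n'` are parallel
  have s1 := he.square (a := f) (b := f') (c := n') (d := n) (fun t => by
    rcases hφψ t with ht | ht
    · left
      exact ⟨blend_of_eq_zero _ _ ht, (blend_of_eq_zero _ _ ht).symm⟩
    · right
      have hnt : n t = f t := blend_of_eq_one _ _ ht
      refine ⟨hnt.symm, ?_⟩
      simp [hf', hn', blend, hnt]) z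
  -- the sides `p q` and `n k` are parallel
  have s2 := he.square (a := p) (b := q) (c := k) (d := n) (fun t => by
    by_cases ht : t ∈ U
    · left
      exact ⟨(hpq t ht).symm, by simp [hn, hk, blend, hpq t ht]⟩
    · right
      exact ⟨(blend_of_eq_zero _ _ (hψU t ht)).symm, (blend_of_eq_zero _ _ (hψU t ht)).symm⟩) z
  have s3 := (he n' k n).1 (fun t => by
    by_cases ht : t ∈ U
    · right
      simp [hn, hk, blend, hpq t ht]
    · left
      have : φ t = 0 := by
        have := hw1 t ht
        simp [φ, this]
      exact (blend_of_eq_zero _ _ this).symm) z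
  -- At `z`, `s1` makes `e n` differ from `e n'` and `s2` makes it differ from `e k`, against `s3`.
  simp only [Set.mem_ofPred_eq] at hz
  grind

omit [T2Space E] [Nontrivial E] [AddCommGroup F] [Module ℝ F] [IsTopologicalAddGroup F]
  [ContinuousSMul ℝ F] [Nontrivial F] in
lemma PreservesBetween.subset_transportOpen_symm [CompletelyRegularSpace X]
    (he : PreservesBetween e) {U : Set X} (hU : IsOpen U) :
    U ⊆ transportOpen e.symm (transportOpen e U) :=
  interior_maximal (fun x hx f g hfg =>
    he.eq_of_eq_on_transportOpen hU (by simpa using hfg) hx) hU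

omit [T2Space E] [AddCommGroup F] [Module ℝ F] [IsTopologicalAddGroup F] [ContinuousSMul ℝ F]
  [Nontrivial F] in
lemma PreservesBetween.transportOpen_nonempty [CompletelyRegularSpace X]
    (he : PreservesBetween e) {U : Set X} (hU : IsOpen U) (hne : U.Nonempty) :
    (transportOpen e U).Nonempty := by
  by_contra! h
  have := he.subset_transportOpen_symm hU
  rw [h, transportOpen_empty] at this
  exact hne.ne_empty (Set.subset_empty_iff.1 this)

omit [T2Space E] [AddCommGroup F] [Module ℝ F] [IsTopologicalAddGroup F] [ContinuousSMul ℝ F]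
  [T2Space F] [Nontrivial F] in
-- Off the closure, two functions equal on `U` can be made to differ; no betweenness is needed.
lemma transportOpen_symm_subset_closure [CompletelyRegularSpace X] (U : Set X) :
    transportOpen e.symm (transportOpen e U) ⊆ closure U := by
  intro x hx
  by_contra hxU
  obtain ⟨a, ha⟩ := exists_ne (0 : E)
  obtain ⟨w, hw0, hw1⟩ := exists_continuous_real_eq_zero_eq_one isClosed_closure.isOpen_compl hxU
  have h := eq_of_mem_transportOpen (e := e.symm)
    (f := e (blend w (ContinuousMap.const X a) (ContinuousMap.const X 0)))
    (g := e (ContinuousMap.const X 0)) (fun y hy => eq_of_mem_transportOpen (fun z hz =>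
      blend_of_eq_one _ _ (hw1 z (fun h => h (subset_closure hz)))) hy) hx
  simp only [Equiv.symm_apply_apply] at h
  rw [blend_of_eq_zero _ _ hw0] at h
  exact ha h

omit [T2Space F] in
/-- If `O` meets the transport of `U`, then `U` meets the transport of `O`. -/
lemma PreservesBetween.inter_transportOpen_nonempty [CompletelyRegularSpace X]
    [CompletelyRegularSpace Y] (he : PreservesBetween e) {U : Set X} {O : Set Y}
    (hO : IsOpen O) (h : (transportOpen e U ∩ O).Nonempty) :
    (transportOpen e.symm O ∩ U).Nonempty := by
  obtain ⟨x, hx⟩ := he.symm.transportOpen_nonempty ((isOpen_transportOpen e U).inter hO) h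
  have hxU := transportOpen_symm_subset_closure U (transportOpen_mono Set.inter_subset_left hx)
  obtain ⟨z, hz, hzU⟩ := mem_closure_iff.1 hxU _ (isOpen_transportOpen _ _) hx
  exact ⟨z, transportOpen_mono Set.inter_subset_right hz, hzU⟩

/-! ### The point correspondence -/

/-- Every transport of a neighbourhood of `x` meets every neighbourhood of `y`. -/
def TransportRel (e : C(X, E) ≃ C(Y, F)) (x : X) (y : Y) : Prop :=
  ∀ U : Set X, ∀ V : Set Y, IsOpen U → IsOpen V → x ∈ U → y ∈ V → (transportOpen e U ∩ V).Nonempty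

lemma TransportRel.symm [CompletelyRegularSpace X] [CompletelyRegularSpace Y]
    (he : PreservesBetween e) {x : X} {y : Y} (h : TransportRel e x y) :
    TransportRel e.symm y x := fun _ _ hV hU hy hx =>
  he.inter_transportOpen_nonempty hV (h _ _ hU hV hx hy)

/-- The relation `TransportRel e` is continuous. -/
lemma TransportRel.exists_nhds [CompletelyRegularSpace X] [CompletelyRegularSpace Y]
    (he : PreservesBetween e) {x : X} {y : Y} (h : TransportRel e x y) {W : Set Y}
    (hW : IsOpen W) (hy : y ∈ W) :
    ∃ U : Set X, IsOpen U ∧ x ∈ U ∧ ∀ x' ∈ U, ∀ y', TransportRel e x' y' → y' ∈ W := by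
  obtain ⟨w, hw0, hw1⟩ := exists_continuous_real_eq_zero_eq_one hW hy
  -- Separated level sets of `w` have transports with disjoint closures, and partners lie in such
  -- closures.
  have hd := ((functionSeparated_lt_gt (E := F) w).transportOpen (e := e.symm)).disjoint_closure
  have key : ∀ (x : X) (y : Y), TransportRel e x y → ∀ V : Set Y, IsOpen V → y ∈ V →
      x ∈ closure (transportOpen e.symm V) := fun x y h V hV hy =>
    mem_closure_iff.2 fun U hU hx => by
      rw [Set.inter_comm]
      exact h.symm he _ _ hV hU hy hx
  have hlt : IsOpen {y | w y < 1 / 3} := isOpen_lt w.continuous continuous_const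
  have hgt : IsOpen {y | 2 / 3 < w y} := isOpen_lt continuous_const w.continuous
  refine ⟨_, isClosed_closure.isOpen_compl, Set.disjoint_left.1 hd (key x y h _ hlt ?_), ?_⟩
  · simp [hw0]
  · intro x' hx' y' h'
    by_contra hy'
    refine hx' (key x' y' h' _ hgt ?_)
    simp only [Set.mem_ofPred_eq, hw1 y' hy']
    norm_num

lemma TransportRel.right_unique [CompletelyRegularSpace X] [T35Space Y]
    (he : PreservesBetween e) {x : X} {y y' : Y} (h : TransportRel e x y)
    (h' : TransportRel e x y') : y = y' := by
  by_contra hne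
  obtain ⟨U, -, hx, H⟩ := h.exists_nhds he (W := {y'}ᶜ) isOpen_compl_singleton hne
  exact H x hx y' h' rfl

/-! ### Existence of partners from realcompactness -/

omit [T2Space F] [Nontrivial F] in
/-- Countably many functions can be glued along the sets where `u` is within `3 / 4` of
`2 * m + p`. -/
lemma exists_glue (u : C(Y, ℝ)) (p : ℝ) (H : ℕ → C(Y, F)) :
    ∃ G : C(Y, F), ∀ (m : ℕ) y, |u y - (2 * m + p)| < 3 / 4 → G y = H m y := by
  let χ : ℕ → Y → ℝ := fun m y => max 0 (min 1 (4 - 4 * |u y - (2 * m + p)|))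
  have hχ0 : ∀ (m : ℕ) y, 1 ≤ |u y - (2 * m + p)| → χ m y = 0 := fun m y h =>
    max_eq_left (min_le_of_right_le (by linarith))
  have hχ1 : ∀ (m : ℕ) y, |u y - (2 * m + p)| < 3 / 4 → χ m y = 1 := fun m y h => by
    simp only [χ]
    rw [min_eq_left (by linarith)]
    norm_num
  have hχc : ∀ m, Continuous (χ m) := fun m => by fun_prop
  have hsupp : ∀ (m : ℕ) y, χ m y • H m y ≠ 0 → |u y - (2 * m + p)| < 1 := fun m y h => by
    by_contra! hle
    exact h (by rw [hχ0 m y hle, zero_smul])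
  refine ⟨⟨fun y => ∑ᶠ m, χ m y • H m y, ?_⟩, fun m y h => ?_⟩
  · refine continuous_finsum (fun m => (hχc m).smul (H m).continuous) fun y => ?_
    refine ⟨{z | u z < u y + 1}, (isOpen_lt u.continuous continuous_const).mem_nhds (by simp), ?_⟩
    obtain ⟨N, hN⟩ := exists_nat_gt (u y + 2 - p)
    refine (Set.finite_Iio N).subset ?_
    rintro m ⟨z, hz, hzu⟩
    have h1 := (abs_lt.1 (hsupp m z hz)).1
    simp only [Set.mem_ofPred_eq] at hzu
    have : (m : ℝ) < N := by
      have : (0 : ℝ) ≤ m := m.cast_nonneg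
      linarith
    exact_mod_cast this
  · simp only [ContinuousMap.coe_mk]
    rw [finsum_eq_single _ m, hχ1 m y h, one_smul]
    intro k hk
    by_contra hne
    have h1 := abs_lt.1 (hsupp k y hne)
    have h2 := abs_lt.1 h
    have h3 : (k : ℝ) < m + 1 := by linarith
    have h4 : (m : ℝ) < k + 1 := by linarith
    have h5 : k < m + 1 := by exact_mod_cast h3
    have h6 : m < k + 1 := by exact_mod_cast h4
    omega

omit [IsTopologicalAddGroup E] [Nontrivial E] in
/-- A continuous function does not take arbitrarily large multiples of a fixed nonzero vector in
all neighbourhoods of a point. -/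
lemma not_frequently_large_smul (f : C(X, E)) (x : X) {a : E} (ha : a ≠ 0) :
    ∃ U : Set X, IsOpen U ∧ x ∈ U ∧ ∃ N : ℝ, ∀ r > N, ∀ z ∈ U, f z ≠ r • a := by
  -- If `f z = r • a`, then `r⁻¹ • f z = a`, yet small multiples of `f` near `x` avoid `a`.
  have ht : Filter.Tendsto (fun q : ℝ × X => q.1 • f q.2) (nhds 0 ×ˢ nhds x) (nhds 0) := by
    have : Continuous (fun q : ℝ × X => q.1 • f q.2) := by fun_prop
    simpa [nhds_prod_eq] using this.tendsto (0, x)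
  have hev := ht (isOpen_compl_singleton.mem_nhds (show (0 : E) ∈ ({a}ᶜ : Set E) from ha.symm))
  obtain ⟨A, hA, B, hB, hAB⟩ := Filter.mem_prod_iff.1 hev
  obtain ⟨U, hUB, hU, hx⟩ := mem_nhds_iff.1 hB
  have hinv : ∀ᶠ r : ℝ in Filter.atTop, r⁻¹ ∈ A := tendsto_inv_atTop_zero hA
  obtain ⟨N, hN⟩ := (hinv.and (Filter.eventually_gt_atTop 0)).exists_forall_of_atTop
  refine ⟨U, hU, hx, N, fun r hr z hz heq => ?_⟩
  obtain ⟨hr1, hr2⟩ := hN r hr.le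
  refine hAB (Set.mk_mem_prod hr1 (hUB hz)) ?_
  simp [heq, smul_smul, inv_mul_cancel₀ hr2.ne']

lemma PreservesBetween.exists_transportRel [CompletelyRegularSpace X] [RealcompactSpace Y]
    (he : PreservesBetween e) (x : X) : ∃ y, TransportRel e x y := by
  let ι : Y → StoneCech Y := stoneCechUnit
  have hι : Continuous ι := continuous_stoneCechUnit
  let S := {U : Set X // IsOpen U ∧ x ∈ U}
  have : Nonempty S := ⟨⟨Set.univ, isOpen_univ, trivial⟩⟩
  obtain ⟨b, hb⟩ := IsCompact.nonempty_iInter_of_directed_nonempty_isCompact_isClosed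
    (fun U : S => closure (ι '' transportOpen e U.1))
    (fun U V => ⟨⟨U.1 ∩ V.1, U.2.1.inter V.2.1, U.2.2, V.2.2⟩,
      closure_mono (Set.image_mono (transportOpen_mono Set.inter_subset_left)),
      closure_mono (Set.image_mono (transportOpen_mono Set.inter_subset_right))⟩)
    (fun U => ((he.transportOpen_nonempty U.2.1 ⟨x, U.2.2⟩).image ι).closure)
    (fun U => isClosed_closure.isCompact) (fun U => isClosed_closure)
  have hb' : ∀ U : Set X, ∀ W : Set (StoneCech Y), IsOpen U → IsOpen W → x ∈ U → b ∈ W →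
      (transportOpen e U ∩ ι ⁻¹' W).Nonempty := fun U W hU hW hx hbW => by
    obtain ⟨_, hz, y, hy, rfl⟩ :=
      mem_closure_iff.1 (Set.mem_iInter.1 hb ⟨U, hU, hx⟩) W hW hbW
    exact ⟨y, hy, hz⟩
  by_cases hbr : b ∈ Set.range ι
  · obtain ⟨y, rfl⟩ := hbr
    refine ⟨y, fun U V hU hV hx hy => ?_⟩
    obtain ⟨W, hW, rfl⟩ := (isInducing_stoneCechUnit (X := Y)).isOpen_iff.1 hV
    exact hb' U W hU hW hx hy
  exfalso
  obtain ⟨g, hg1, hglt⟩ := RealcompactSpace.exists_eq_one_lt_one b hbr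
  have hpos : ∀ y, 0 < 1 - (g (ι y) : ℝ) := fun y => sub_pos.2 (by exact_mod_cast hglt y)
  let u : C(Y, ℝ) := ⟨fun y => (1 - (g (ι y) : ℝ))⁻¹,
    Continuous.inv₀ (by fun_prop) fun y => (hpos y).ne'⟩
  have hu0 : ∀ y, 0 < u y := fun y => inv_pos.2 (hpos y)
  -- Bands about integers of one parity can be glued; since `3 / 4 > 1 / 2`, the two parities cover
  -- `Y`.
  let V : ℝ → Set Y := fun p => {y | ∃ m : ℕ, |u y - (2 * m + p)| < 3 / 4}
  have hcover : ∀ y, y ∈ V 0 ∨ y ∈ V 1 := by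
    intro y
    have h1 := Nat.floor_le (a := u y + 1 / 2) (by linarith [hu0 y])
    have h2 := Nat.lt_floor_add_one (u y + 1 / 2)
    rcases Nat.even_or_odd' ⌊u y + 1 / 2⌋₊ with ⟨m, hm | hm⟩ <;> rw [hm] at h1 h2 <;>
      push_cast at h1 h2
    · exact Or.inl ⟨m, abs_lt.2 ⟨by linarith, by linarith⟩⟩
    · exact Or.inr ⟨m, abs_lt.2 ⟨by linarith, by linarith⟩⟩
  obtain ⟨p, hp1, hp⟩ : ∃ p : ℝ, p ≤ 1 ∧ ∀ U : Set X, ∀ W : Set (StoneCech Y), IsOpen U → IsOpen W →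
      x ∈ U → b ∈ W → (transportOpen e U ∩ ι ⁻¹' W ∩ V p).Nonempty := by
    by_contra! H
    obtain ⟨U0, W0, hU0, hW0, hx0, hb0, h0⟩ := H 0 zero_le_one
    obtain ⟨U1, W1, hU1, hW1, hx1, hb1, h1⟩ := H 1 le_rfl
    obtain ⟨y, hyU, hyW⟩ := hb' (U0 ∩ U1) (W0 ∩ W1) (hU0.inter hU1) (hW0.inter hW1)
      ⟨hx0, hx1⟩ ⟨hb0, hb1⟩
    rcases hcover y with hy | hy
    · exact h0.subset ⟨⟨transportOpen_mono Set.inter_subset_left hyU, hyW.1⟩, hy⟩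
    · exact h1.subset ⟨⟨transportOpen_mono Set.inter_subset_right hyU, hyW.2⟩, hy⟩
  obtain ⟨a, ha⟩ := exists_ne (0 : E)
  obtain ⟨G, hG⟩ := exists_glue u p fun m => e (ContinuousMap.const X ((m : ℝ) • a))
  obtain ⟨U, hU, hx, N, hN⟩ := not_frequently_large_smul (e.symm G) x ha
  -- In band `m`, `u < 2 * m + 7 / 4`, so `u > M` forces `m > N`.
  let M : ℝ := 2 * |N| + 2
  have hM : 0 < M := by positivity
  obtain ⟨y, ⟨hyU, hyW⟩, m, hm⟩ := hp U {z | 1 - (g z : ℝ) < M⁻¹} hU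
    (isOpen_lt (by fun_prop) continuous_const) hx (by simp [hg1, hM])
  have huM : M < u y := (lt_inv_comm₀ (hpos y) hM).1 hyW
  have hmN : (m : ℝ) > N := by
    have := (abs_lt.1 hm).2
    have := le_abs_self N
    simp only [M] at huM
    linarith
  obtain ⟨z, hz, hzU⟩ := he.inter_transportOpen_nonempty
    (O := {y | |u y - (2 * m + p)| < 3 / 4})
    (isOpen_lt (by fun_prop) continuous_const) ⟨y, hyU, hm⟩
  have := eq_of_mem_transportOpen (e := e.symm) (fun y hy => hG m y hy) hz
  rw [Equiv.symm_apply_apply] at this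
  exact hN m hmN z hzU this

lemma PreservesBetween.nonempty_homeomorph [RealcompactSpace X] [RealcompactSpace Y]
    (he : PreservesBetween e) : Nonempty (X ≃ₜ Y) := by
  choose φ hφ using he.exists_transportRel
  choose ψ hψ using he.symm.exists_transportRel
  refine ⟨⟨⟨φ, ψ, fun x => ?_, fun y => ?_⟩, ?_, ?_⟩⟩
  · exact (hψ (φ x)).right_unique he.symm ((hφ x).symm he)
  · exact (hφ (ψ y)).right_unique he ((hψ y).symm he.symm)
  · refine continuous_iff_continuousAt.2 fun x W hW => ?_
    obtain ⟨O, hOW, hO, hx⟩ := mem_nhds_iff.1 hW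
    obtain ⟨U, hU, hxU, H⟩ := (hφ x).exists_nhds he hO hx
    exact Filter.mem_map.2 (Filter.mem_of_superset (hU.mem_nhds hxU) fun z hz => hOW (H z hz _ (hφ z)))
  · refine continuous_iff_continuousAt.2 fun y W hW => ?_
    obtain ⟨O, hOW, hO, hy⟩ := mem_nhds_iff.1 hW
    obtain ⟨U, hU, hyU, H⟩ := (hψ y).exists_nhds he.symm hO hy
    exact Filter.mem_map.2 (Filter.mem_of_superset (hU.mem_nhds hyU) fun z hz => hOW (H z hz _ (hψ z)))

end Real

lemma disjointWrt_iff_forall {X E : Type*} [AddGroup E] (h f g : X → E) :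
    DisjointWrt h f g ↔ ∀ x, h x = f x ∨ h x = g x := by
  simp only [DisjointWrt, carrier, Set.eq_empty_iff_forall_notMem, Set.mem_inter_iff,
    Set.mem_ofPred_eq, Pi.sub_apply, sub_ne_zero, not_and_or, not_not]
  simp only [eq_comm]

lemma continuousSMul_real_compHom (𝕜 : Type*) {E : Type*} [RCLike 𝕜] [AddCommGroup E] [Module 𝕜 E]
    [TopologicalSpace E] [ContinuousSMul 𝕜 E] :
    let _ := Module.compHom E (algebraMap ℝ 𝕜)
    ContinuousSMul ℝ E := by
  let _ := Module.compHom E (algebraMap ℝ 𝕜)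
  have h : Continuous fun q : ℝ × E => ((q.1 : 𝕜)) • q.2 :=
    (RCLike.continuous_ofReal.comp continuous_fst).smul continuous_snd
  exact ⟨h⟩

theorem theorem3p7 {X Y E F 𝕜 𝕂 : Type*}
    [TopologicalSpace X] [RealcompactSpace X]
    [TopologicalSpace Y] [RealcompactSpace Y]
    [RCLike 𝕜] [AddCommGroup E] [Module 𝕜 E] [TopologicalSpace E] [IsTopologicalAddGroup E]
    [ContinuousSMul 𝕜 E] [T2Space E] [Nontrivial E]
    [RCLike 𝕂] [AddCommGroup F] [Module 𝕂 F] [TopologicalSpace F] [IsTopologicalAddGroup F]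
    [ContinuousSMul 𝕂 F] [T2Space F] [Nontrivial F]
    (T : C(X, E) → C(Y, F)) (hT : IsBiseparating T) :
    Nonempty (X ≃ₜ Y) := by
  let _ := Module.compHom E (algebraMap ℝ 𝕜)
  let _ := Module.compHom F (algebraMap ℝ 𝕂)
  have := continuousSMul_real_compHom 𝕜 (E := E)
  have := continuousSMul_real_compHom 𝕂 (E := F)
  refine PreservesBetween.nonempty_homeomorph (e := Equiv.ofBijective T hT.bijective) ?_
  intro f g h
  have := hT.disjointWrt_iff f g h
  rwa [disjointWrt_iff_forall, disjointWrt_iff_forall] at this
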